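/- Let $Q_1,Q_2,Q_3\in\mathbb R[u,v,w]$ be quadratic forms (homogeneous polynomials of degree $2$) such that the plane quartic curve $\Delta=(Q_1Q_3-Q_2^2=0)\subset\mathbb P^2$ is smooth, i.e. there is no point of $\mathbb P^2(\mathbb C)$ at which $Q_1Q_3-Q_2^2$ and all its first partial derivatives vanish. Let $Y\to\mathbb P^1_{[t_0:t_1]}\times\mathbb P^2_{[u:v:w]}$ be the double cover defined by $$z^2=t_0^2\,Q_1(u,v,w)+2t_0t_1\,Q_2(u,v,w)+t_1^2\,Q_3(u,v,w),$$ where $z$ has bidegree $(1,1)$. Thus $Y(\mathbb R)$ is the set of real solutions $(t_0,t_1;u,v,w;z)$ of this equation with $(t_0,t_1)\ne(0,0)$ and $(u,v,w)\neq(0,0,0)$, modulo the scalings $(t_0,t_1;u,v,w;z)\sim(at_0,at_1;bu,bv,bw;abz)$ for $a,b\in\mathbb R^\times$, with its Euclidean topology (the quotient topology). Then $Y(\mathbb R)$ has at most three connected components. -/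

import Mathlib

namespace DoubleCover

/-- The homogeneous polynomial `f` in three variables over `ℝ` defines a smooth plane curve: at no
point of `ℙ²(ℂ)` do `f` and all its first partial derivatives vanish. -/
def IsSmoothPlaneCurve (f : MvPolynomial (Fin 3) ℝ) : Prop :=
  ∀ p : Fin 3 → ℂ, p ≠ 0 → MvPolynomial.aeval p f = 0 →
    ∃ i : Fin 3, MvPolynomial.aeval p (MvPolynomial.pderiv i f) ≠ 0

/-- The homogeneous coordinates `(t, x, z)`, `t = (t₀, t₁) ≠ 0`, `x = (u, v, w) ≠ 0`, of the real
points of the double cover `z² = t₀² Q₁(x) + 2 t₀ t₁ Q₂(x) + t₁² Q₃(x)` of `ℙ¹ × ℙ²`. -/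
def coordinates (Q₁ Q₂ Q₃ : MvPolynomial (Fin 3) ℝ) :
    Set ((Fin 2 → ℝ) × (Fin 3 → ℝ) × ℝ) :=
  {p | p.1 ≠ 0 ∧ p.2.1 ≠ 0 ∧
    p.2.2 ^ 2 = p.1 0 ^ 2 * MvPolynomial.eval p.2.1 Q₁
      + 2 * p.1 0 * p.1 1 * MvPolynomial.eval p.2.1 Q₂
      + p.1 1 ^ 2 * MvPolynomial.eval p.2.1 Q₃}

/-- Two coordinate vectors give the same point when they differ by the scaling
`(t, x, z) ↦ (a t, b x, a b z)` with `a, b ∈ ℝˣ`. The coordinate `z` has bidegree `(1, 1)`: it is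
the fibre coordinate of the line bundle `𝒪(1, 1)`, in which the double cover lives. -/
def scaling (Q₁ Q₂ Q₃ : MvPolynomial (Fin 3) ℝ) : Setoid (coordinates Q₁ Q₂ Q₃) where
  r p q := ∃ a b : ℝˣ, q.1 =
    ((a : ℝ) • p.1.1, (b : ℝ) • p.1.2.1, (a : ℝ) * (b : ℝ) * p.1.2.2)
  iseqv :=
    { refl := fun p => ⟨1, 1, by simp⟩
      symm := by
        rintro p q ⟨a, b, h⟩
        refine ⟨a⁻¹, b⁻¹, ?_⟩
        rw [h]
        refine Prod.ext ?_ (Prod.ext ?_ ?_)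
        · simp [smul_smul]
        · simp [smul_smul]
        · have ha := a.ne_zero
          have hb := b.ne_zero
          simp only [Units.val_inv_eq_inv_val]
          field_simp
      trans := by
        rintro p q r ⟨a, b, h⟩ ⟨c, d, k⟩
        refine ⟨c * a, d * b, ?_⟩
        rw [k, h]
        refine Prod.ext ?_ (Prod.ext ?_ ?_)
        · simp [smul_smul]
        · simp [smul_smul]
        · simp only [Units.val_mul]
          ring }

/-- The real locus `Y(ℝ)` of the double cover `Y → ℙ¹ × ℙ²` with equation
`z² = t₀² Q₁ + 2 t₀ t₁ Q₂ + t₁² Q₃`. -/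
def RealLocus (Q₁ Q₂ Q₃ : MvPolynomial (Fin 3) ℝ) : Type :=
  Quotient (scaling Q₁ Q₂ Q₃)

/-- The Euclidean topology on `Y(ℝ)`: the quotient of the subspace topology from
`ℝ² × ℝ³ × ℝ`. -/
instance (Q₁ Q₂ Q₃ : MvPolynomial (Fin 3) ℝ) : TopologicalSpace (RealLocus Q₁ Q₂ Q₃) :=
  inferInstanceAs (TopologicalSpace (Quotient (scaling Q₁ Q₂ Q₃)))

end DoubleCover

/-!
Let `N(t)` be the symmetric matrix of the quadratic form `-(t₀² Q₁ + 2 t₀ t₁ Q₂ + t₁² Q₃)`. The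
fibre of `Y(ℝ) → ℙ¹(ℝ)` over `t` is the real quadric `xᵀ N(t) x + z² = 0` in `ℙ³`, which is
connected, and is empty exactly when `N(t)` is positive definite. Hence `Y(ℝ)` has at most as many
components as its image, the set of `t` with `N(t)` not positive definite. If this set is not all
of `ℙ¹(ℝ)`, it is a bounded subset of an affine chart. Replace `N` by `N - ε` for a small `ε > 0`:
on each component some matrix is then not even semidefinite, while between the components positive
definite matrices remain, so the determinant vanishes at least twice for each component. It has
degree at most six, which leaves at most three components.
-/

namespace DoubleCover

open Matrix Polynomial Set Filter Topology
open scoped ComplexOrder Finset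

section PositiveDefinite

variable {X 𝕜 n : Type*} [TopologicalSpace X] [RCLike 𝕜] {M : X → Matrix n n 𝕜}

theorem not_posDef_iff_exists_mem_sphere [Fintype n] {A : Matrix n n 𝕜} (hA : A.IsHermitian) :
    ¬ A.PosDef ↔
      ∃ v ∈ Metric.sphere (0 : n → 𝕜) 1, RCLike.re (star v ⬝ᵥ A *ᵥ v) ≤ 0 := by
  constructor
  · intro h
    obtain ⟨v, hv, hle⟩ : ∃ v ≠ 0, RCLike.re (star v ⬝ᵥ A *ᵥ v) ≤ 0 := by
      by_contra! hpos
      exact h (.of_dotProduct_mulVec_pos hA fun v hv =>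
        RCLike.pos_iff.2 ⟨hpos v hv, hA.im_star_dotProduct_mulVec_self v⟩)
    refine ⟨(‖v‖ : 𝕜)⁻¹ • v, ?_, ?_⟩
    · simpa using norm_smul_inv_norm (𝕜 := 𝕜) hv
    · have hscale : star ((‖v‖ : 𝕜)⁻¹ • v) ⬝ᵥ A *ᵥ ((‖v‖ : 𝕜)⁻¹ • v) =
          ((‖v‖⁻¹ ^ 2 : ℝ) : 𝕜) * (star v ⬝ᵥ A *ᵥ v) := by
        simp only [star_smul, RCLike.star_def, map_inv₀, RCLike.conj_ofReal, mulVec_smul,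
          smul_dotProduct, dotProduct_smul, smul_eq_mul, RCLike.ofReal_pow]
        ring
      rw [hscale, RCLike.re_ofReal_mul]
      exact mul_nonpos_of_nonneg_of_nonpos (by positivity) hle
  · rintro ⟨v, hv, hle⟩ h
    exact (h.re_dotProduct_pos (ne_zero_of_mem_unit_sphere ⟨v, hv⟩)).not_ge hle

theorem isOpen_setOf_posDef [Finite n] (hM : Continuous M)
    (hherm : ∀ x, (M x).IsHermitian) :
    IsOpen {x | (M x).PosDef} := by
  cases nonempty_fintype n
  let K : Set (X × Metric.sphere (0 : n → 𝕜) 1) :=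
    {y | RCLike.re (star y.2.1 ⬝ᵥ M y.1 *ᵥ y.2.1) ≤ 0}
  have hK : IsClosed K := by
    refine isClosed_le (RCLike.continuous_re.comp ?_) continuous_const
    fun_prop
  have hcompl : {x | (M x).PosDef}ᶜ = Prod.fst '' K := by
    ext x
    simp [K, not_posDef_iff_exists_mem_sphere (hherm x)]
  rw [← isClosed_compl_iff, hcompl]
  exact isClosedMap_fst_of_compactSpace _ hK

theorem isClosed_setOf_posSemidef [Finite n] (hM : Continuous M)
    (hherm : ∀ x, (M x).IsHermitian) :
    IsClosed {x | (M x).PosSemidef} := by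
  cases nonempty_fintype n
  simp only [posSemidef_iff_dotProduct_mulVec, hherm, true_and, ofPred_forall]
  exact isClosed_iInter fun v => isClosed_le continuous_const (by fun_prop)

theorem exists_det_eq_zero_of_mem_closure [Fintype n] [DecidableEq n] (hM : Continuous M)
    (hherm : ∀ x, (M x).IsHermitian) {T : Set X} (hT : IsPreconnected T) {a b : X} (haT : a ∈ T)
    (ha : (M a).PosDef) (hbT : b ∈ closure T) (hb : ¬ (M b).PosSemidef) :
    ∃ c ∈ T, (M c).det = 0 := by
  by_contra! hdet
  have hsemi : IsClosed {x | (M x).PosSemidef} := isClosed_setOf_posSemidef hM hherm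
  have hpos : T ⊆ {x | (M x).PosDef} := by
    refine hT.subset_of_closure_inter_subset (isOpen_setOf_posDef hM hherm) ⟨a, haT, ha⟩ ?_
    rintro x ⟨hx, hxT⟩
    have hx' : (M x).PosSemidef := closure_minimal (fun _ h => h.posSemidef) hsemi hx
    exact hx'.posDef_iff_det_ne_zero.2 (hdet x hxT)
  exact hb (closure_minimal (fun x hx => (hpos hx).posSemidef) hsemi hbT)

theorem exists_pos_forall_posDef_sub_smul_one [Finite n] [DecidableEq n] {ι : Type*} {N : Finset ι}
    {A : ι → Matrix n n 𝕜} (hA : ∀ i ∈ N, (A i).PosDef) :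
    ∃ ε : ℝ, 0 < ε ∧ ∀ i ∈ N, (A i - ε • (1 : Matrix n n 𝕜)).PosDef := by
  have hev : ∀ᶠ ε : ℝ in 𝓝[>] 0, ∀ i ∈ N, (A i - ε • (1 : Matrix n n 𝕜)).PosDef := by
    refine nhdsWithin_le_nhds ((eventually_all_finset N).2 fun i hi => ?_)
    refine (isOpen_setOf_posDef (by fun_prop) fun ε => ?_).mem_nhds (by simpa using hA i hi)
    exact (hA i hi).isHermitian.sub (isHermitian_one.smul (IsSelfAdjoint.all ε))
  exact (eventually_mem_nhdsWithin.and hev).exists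

theorem not_posSemidef_sub_smul_one [Finite n] [DecidableEq n] {A : Matrix n n 𝕜} (hA : ¬ A.PosDef)
    {ε : ℝ} (hε : 0 < ε) : ¬ (A - ε • (1 : Matrix n n 𝕜)).PosSemidef := fun h =>
  hA (by simpa using PosDef.posSemidef_add h (PosDef.one.smul hε))

end PositiveDefinite

section Separation

/-- The set `F` has a point of `N` below it, a point of `N` above it, and a point of `N` strictly
between any two of its elements. The outer points are required for each element of `F`, so that
the condition is void for `F = ∅`. -/
def Separates {α : Type*} [LT α] (N F : Set α) : Prop :=
  ∀ s ∈ F, (∃ ν ∈ N, ν < s) ∧ (∃ ν ∈ N, s < ν) ∧ ∀ s' ∈ F, s < s' → ∃ ν ∈ N, s < ν ∧ ν < s'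

variable {α : Type*} [LinearOrder α]

theorem Separates.mono_right {N F F' : Set α} (h : Separates N F) (hF : F' ⊆ F) :
    Separates N F' := fun s hs =>
  ⟨(h s (hF hs)).1, (h s (hF hs)).2.1, fun s' hs' => (h s (hF hs)).2.2 s' (hF hs')⟩

theorem Separates.exists_finset_subset {N : Set α} {F : Finset α} (h : Separates N F) :
    ∃ N' : Finset α, ↑N' ⊆ N ∧ Separates (N' : Set α) F := by
  choose! lo hlo hlo_lt using fun s hs => (h s hs).1
  choose! hi hhi hlt_hi using fun s hs => (h s hs).2.1
  choose! mid hmid hlt_mid using fun s hs => (h s hs).2.2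
  refine ⟨F.image lo ∪ F.image hi ∪ {p ∈ F ×ˢ F | p.1 < p.2}.image fun p => mid p.1 p.2, ?_,
    fun s hs => ⟨⟨lo s, ?_, hlo_lt s hs⟩, ⟨hi s, ?_, hlt_hi s hs⟩,
      fun s' hs' hlt => ⟨mid s s', ?_, hlt_mid s hs s' hs' hlt⟩⟩⟩
  · intro ν hν
    simp only [Finset.coe_union, Finset.coe_image, Finset.coe_filter, Finset.mem_product] at hν
    rcases hν with (⟨s, hs, rfl⟩ | ⟨s, hs, rfl⟩) | ⟨p, ⟨⟨hp, hp'⟩, hlt⟩, rfl⟩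
    exacts [hlo s hs, hhi s hs, hmid _ hp _ hp' hlt]
  · exact Finset.mem_union_left _ (Finset.mem_union_left _ (Finset.mem_image_of_mem lo hs))
  · exact Finset.mem_union_left _ (Finset.mem_union_right _ (Finset.mem_image_of_mem hi hs))
  · refine Finset.mem_union_right _ (Finset.mem_image.2 ⟨(s, s'), ?_, rfl⟩)
    exact Finset.mem_filter.2 ⟨Finset.mem_product.2 ⟨hs, hs'⟩, hlt⟩

theorem Separates.exists_between_max {N : Set α} {F : Finset α} {m : α}
    (h : Separates N (insert m F : Finset α)) (hm : ∀ s ∈ F, s < m) :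
    ∃ ν ∈ N, (∀ s ∈ F, s < ν) ∧ ν < m := by
  rcases F.eq_empty_or_nonempty with rfl | hF
  · simpa using (h m (by simp)).1
  · obtain ⟨ν, hν, hlt, hνm⟩ := (h (F.max' hF) (by simp [F.max'_mem])).2.2 m (by simp)
      (hm _ (F.max'_mem hF))
    exact ⟨ν, hν, fun s hs => (F.le_max' s hs).trans_lt hlt, hνm⟩

theorem Separates.mul_card_le_card_filter_lt {N : Set α} {F Z : Finset α} {k : ℕ}
    (h : Separates N F)
    (hZ : ∀ s ∈ F, ∀ ν ∈ N, ∀ ν' ∈ N, ν < s → s < ν' → k ≤ #{z ∈ Z | ν < z ∧ z < ν'}) {b : α}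
    (hb : b ∈ N) (hFb : ∀ s ∈ F, s < b) : k * #F ≤ #{z ∈ Z | z < b} := by
  induction F using Finset.induction_on_max generalizing b with
  | empty => simp
  | insert m F hm ih =>
    obtain ⟨ν, hν, hFν, hνm⟩ := h.exists_between_max hm
    have hbelow : k * #F ≤ #{z ∈ Z | z < ν} :=
      ih (h.mono_right (by simp)) (fun s hs => hZ s (by simp [hs])) hν hFν
    have habove : k ≤ #{z ∈ Z | ν < z ∧ z < b} :=
      hZ m (by simp) ν hν b hb hνm (hFb m (by simp))
    calc k * #(insert m F) = k * #F + k := by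
          rw [Finset.card_insert_of_notMem fun h => (hm m h).false, mul_add_one]
      _ ≤ #{z ∈ Z | z < ν} + #{z ∈ Z | ν < z ∧ z < b} := add_le_add hbelow habove
      _ = #({z ∈ Z | z < ν} ∪ {z ∈ Z | ν < z ∧ z < b}) := by
          refine (Finset.card_union_of_disjoint ?_).symm
          exact Finset.disjoint_filter.2 fun z _ h h' => h.not_gt h'.1
      _ ≤ #{z ∈ Z | z < b} := by
          refine Finset.card_le_card (Finset.union_subset ?_ ?_)
          · exact Finset.monotone_filter_right _ fun z _ h =>
              h.trans (hνm.trans (hFb m (by simp)))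
          · exact Finset.monotone_filter_right _ fun z _ h => h.2

theorem Separates.mul_card_le_card {N : Set α} {F Z : Finset α} {k : ℕ} (h : Separates N F)
    (hZ : ∀ s ∈ F, ∀ ν ∈ N, ∀ ν' ∈ N, ν < s → s < ν' → k ≤ #{z ∈ Z | ν < z ∧ z < ν'}) :
    k * #F ≤ #Z := by
  rcases F.eq_empty_or_nonempty with rfl | hF
  · simp
  · obtain ⟨b, hb, hFb⟩ := (h _ (F.max'_mem hF)).2.1
    exact (h.mul_card_le_card_filter_lt hZ hb fun s hs => (F.le_max' s hs).trans_lt hFb).trans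
      (Finset.card_filter_le _ _)

end Separation

section Polynomial

theorem natDegree_det_le {R n : Type*} [CommRing R] [Fintype n] [DecidableEq n]
    {P : Matrix n n R[X]} {d : ℕ} (hP : ∀ i j, (P i j).natDegree ≤ d) :
    P.det.natDegree ≤ Fintype.card n * d := by
  rw [det_apply]
  refine natDegree_sum_le_of_forall_le _ _ fun σ _ => ?_
  calc (Equiv.Perm.sign σ • ∏ i, P (σ i) i).natDegree
      ≤ (∏ i, P (σ i) i).natDegree := natDegree_smul_le _ _
    _ ≤ ∑ i, (P (σ i) i).natDegree := natDegree_prod_le _ _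
    _ ≤ ∑ _i : n, d := Finset.sum_le_sum fun i _ => hP _ _
    _ = Fintype.card n * d := by simp

theorem eval_det_eq {R n : Type*} [CommRing R] [Fintype n] [DecidableEq n]
    (P : Matrix n n R[X]) (s : R) : P.det.eval s = (P.map (eval s)).det :=
  (evalRingHom s).map_det P

variable {n : Type*} {P : Matrix n n ℝ[X]}

theorem continuous_map_eval : Continuous fun s : ℝ => P.map (eval s) :=
  continuous_matrix fun i j => (P i j).continuous

theorem isHermitian_map_eval (hP : P.IsSymm) (s : ℝ) : (P.map (eval s)).IsHermitian :=
  (conjTranspose_eq_transpose_of_trivial _).trans (hP.map _)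

variable [Fintype n]

theorem two_le_card_roots_det_filter [DecidableEq n] (hP : P.IsSymm) {ν s ν' : ℝ}
    (hν : (P.map (eval ν)).PosDef) (hs : ¬ (P.map (eval s)).PosSemidef)
    (hν' : (P.map (eval ν')).PosDef) (hνs : ν < s) (hsν' : s < ν') :
    2 ≤ #{z ∈ P.det.roots.toFinset | ν < z ∧ z < ν'} := by
  have hroot : ∀ z, (P.map (eval z)).det = 0 → z ∈ P.det.roots.toFinset := by
    intro z hz
    have hdet : P.det ≠ 0 := fun h => hν.det_pos.ne' (by rw [← eval_det_eq, h, eval_zero])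
    simpa [hdet, eval_det_eq] using hz
  have hexit := fun {T : Set ℝ} => exists_det_eq_zero_of_mem_closure (T := T)
    (continuous_map_eval (P := P)) (isHermitian_map_eval hP)
  obtain ⟨c, hc, hc0⟩ := hexit isPreconnected_Ico (left_mem_Ico.2 hνs) hν
    (by simp [closure_Ico hνs.ne, hνs.le]) hs
  obtain ⟨d, hd, hd0⟩ := hexit isPreconnected_Ioc (right_mem_Ioc.2 hsν') hν'
    (by simp [closure_Ioc hsν'.ne, hsν'.le]) hs
  have hνc : ν < c := hc.1.lt_of_ne fun h => hν.det_pos.ne' (h ▸ hc0)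
  have hdν' : d < ν' := hd.2.lt_of_ne fun h => hν'.det_pos.ne' (h ▸ hd0)
  refine Finset.one_lt_card.2 ⟨c, ?_, d, ?_, (hc.2.trans hd.1).ne⟩
  · exact Finset.mem_filter.2 ⟨hroot c hc0, hνc, hc.2.trans hsν'⟩
  · exact Finset.mem_filter.2 ⟨hroot d hd0, hνs.trans hd.1, hdν'⟩

theorem two_mul_card_le_of_separates (hP : P.IsSymm) {d : ℕ} (hd : ∀ i j, (P i j).natDegree ≤ d)
    {F : Finset ℝ} (hF : ∀ s ∈ F, ¬ (P.map (eval s)).PosDef)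
    (hsep : Separates {ν | (P.map (eval ν)).PosDef} F) : 2 * #F ≤ Fintype.card n * d := by
  classical
  obtain ⟨N, hN, hNF⟩ := hsep.exists_finset_subset
  obtain ⟨ε, hε, hNε⟩ := exists_pos_forall_posDef_sub_smul_one (N := N) fun ν hν => hN hν
  -- Lowering `P` by `ε` makes the matrices at `F` not even semidefinite, so that the determinant
  -- has distinct roots on the two sides of each point of `F`.
  set P' : Matrix n n ℝ[X] := P - (ε • (1 : Matrix n n ℝ)).map C
  have heval : ∀ s, P'.map (eval s) = P.map (eval s) - ε • (1 : Matrix n n ℝ) := by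
    intro s
    ext i j
    simp [P']
  have hsymm : P'.IsSymm := hP.sub ((isSymm_one.smul ε).map C)
  have hdeg : ∀ i j, (P' i j).natDegree ≤ d := fun i j =>
    (natDegree_sub_C (p := P i j)).le.trans (hd i j)
  calc 2 * #F ≤ #P'.det.roots.toFinset := by
        refine hNF.mul_card_le_card fun s hs ν hν ν' hν' => ?_
        refine two_le_card_roots_det_filter hsymm ?_ ?_ ?_
        · exact heval ν ▸ hNε ν hν
        · exact heval s ▸ not_posSemidef_sub_smul_one (hF s hs) hε
        · exact heval ν' ▸ hNε ν' hν'
    _ ≤ Multiset.card P'.det.roots := Multiset.toFinset_card_le _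
    _ ≤ P'.det.natDegree := card_roots' _
    _ ≤ Fintype.card n * d := natDegree_det_le hdeg

end Polynomial

section Components

theorem eq_of_joined {X : Type*} [TopologicalSpace X] [TotallyDisconnectedSpace X] {x y : X}
    (h : Joined x y) : x = y := by
  have hy : y ∈ connectedComponent x := pathComponent_subset_component x h
  rw [connectedComponent_eq_singleton] at hy
  exact hy.symm

theorem card_le_card_connectedComponents {X Y : Type*} [TopologicalSpace X] [TopologicalSpace Y]
    [TotallyDisconnectedSpace Y] {f : X → Y} (hf : Continuous f) (hsurj : Function.Surjective f) :
    ENat.card Y ≤ ENat.card (ConnectedComponents X) := by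
  have hlift : Function.Surjective hf.connectedComponentsLift :=
    .of_comp (g := ConnectedComponents.mk) (by rwa [hf.connectedComponentsLift_comp_coe])
  exact ENat.card_le_card_of_injective (Function.injective_surjInv hlift)

theorem enatCard_le_of_forall_finset_card_le {α : Type*} {k : ℕ} (h : ∀ T : Finset α, #T ≤ k) :
    ENat.card α ≤ k := by
  let _ := fintypeOfFinsetCardLe k h
  rw [ENat.card_eq_coe_fintype_card]
  exact_mod_cast h Finset.univ

variable {α : Type*} [ConditionallyCompleteLinearOrder α] [TopologicalSpace α] [OrderTopology α]
  [DenselyOrdered α] {S : Set α}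

theorem exists_notMem_of_connectedComponents_ne {x y : S} (hxy : x < y)
    (hne : (x : ConnectedComponents S) ≠ y) : ∃ r ∉ S, (x : α) < r ∧ r < y := by
  by_contra! hS
  have hIcc : Icc (x : α) y ⊆ S := by
    intro r hr
    by_contra hrS
    have hxr : (x : α) < r := hr.1.lt_of_ne fun h => hrS (h ▸ x.2)
    exact hrS ((hr.2.antisymm (hS r hrS hxr)) ▸ y.2)
  have hconn : IsPreconnected ((↑) ⁻¹' Icc (x : α) y : Set S) := by
    rw [← IsInducing.subtypeVal.isPreconnected_image,
      Subtype.image_preimage_coe, inter_eq_right.2 hIcc]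
    exact isPreconnected_Icc
  exact hne (ConnectedComponents.coe_eq_coe'.2
    (hconn.subset_connectedComponent ⟨hxy.le, le_rfl⟩ ⟨le_rfl, hxy.le⟩))

variable [NoMinOrder α] [NoMaxOrder α]

theorem separates_compl_of_injOn (hbelow : BddBelow S) (habove : BddAbove S) {F : Set S}
    (hF : F.InjOn ((↑) : S → ConnectedComponents S)) : Separates Sᶜ ((↑) '' F) := by
  rintro _ ⟨x, hx, rfl⟩
  obtain ⟨⟨a, ha⟩, b, hb⟩ := And.intro hbelow habove
  obtain ⟨⟨a', ha'⟩, b', hb'⟩ := And.intro (exists_lt a) (exists_gt b)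
  refine ⟨⟨a', fun h => (ha h).not_gt ha', ha'.trans_le (ha x.2)⟩,
    ⟨b', fun h => (hb h).not_gt hb', (hb x.2).trans_lt hb'⟩, ?_⟩
  rintro _ ⟨y, hy, rfl⟩ hxy
  exact exists_notMem_of_connectedComponents_ne hxy fun h =>
    hxy.ne (congrArg Subtype.val (hF hx hy h))

theorem card_connectedComponents_le_of_separates (hbelow : BddBelow S) (habove : BddAbove S)
    {k : ℕ} (h : ∀ F : Finset α, ↑F ⊆ S → Separates Sᶜ (F : Set α) → #F ≤ k) :
    ENat.card (ConnectedComponents S) ≤ k := by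
  refine enatCard_le_of_forall_finset_card_le fun T => ?_
  let rep : ConnectedComponents S ↪ S :=
    ⟨Function.surjInv ConnectedComponents.surjective_coe, Function.injective_surjInv _⟩
  have hrep : (T.map rep : Set S).InjOn ((↑) : S → ConnectedComponents S) := by
    have hinj : Function.Injective (((↑) : S → ConnectedComponents S) ∘ rep) :=
      fun c c' h => by simpa [rep, Function.surjInv_eq] using h
    exact hinj.injOn_range.mono (by simp)
  rw [← T.card_map rep, ← (T.map rep).card_map (.subtype _)]
  refine h _ (by simp) ?_
  simpa using separates_compl_of_injOn hbelow habove hrep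

theorem card_connectedComponents_not_posDef_le {n : Type*} [Fintype n] {P : Matrix n n ℝ[X]}
    (hP : P.IsSymm) {d : ℕ} (hd : ∀ i j, (P i j).natDegree ≤ d)
    (hbdd : Bornology.IsBounded {s | ¬ (P.map (eval s)).PosDef}) :
    ENat.card (ConnectedComponents {s | ¬ (P.map (eval s)).PosDef}) ≤
      (Fintype.card n * d / 2 : ℕ) := by
  refine card_connectedComponents_le_of_separates hbdd.bddBelow hbdd.bddAbove fun F hF hsep => ?_
  rw [Nat.le_div_iff_mul_le two_pos, mul_comm]
  exact two_mul_card_le_of_separates hP hd (fun s hs => hF hs) (by simpa [compl_ofPred] using hsep)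

end Components

section Quadric

variable {V : Type*} [AddCommGroup V] [Module ℝ V]

/-- The nonzero isotropic vectors of a quadratic form: the punctured affine cone over the
projective quadric that the form defines. -/
def isotropicCone (Q : QuadraticForm ℝ V) : Set V := {v | v ≠ 0 ∧ Q v = 0}

variable [TopologicalSpace V] [ContinuousAdd V] [ContinuousSMul ℝ V] {Q : QuadraticForm ℝ V}

theorem exists_joinedIn_isotropicCone_of_polar_eq_zero {v w : V} (hv : v ∈ isotropicCone Q)
    (hw : w ∈ isotropicCone Q) (hvw : QuadraticMap.polar Q v w = 0) :
    ∃ c : ℝ, c ≠ 0 ∧ JoinedIn (isotropicCone Q) v (c • w) := by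
  by_cases hli : LinearIndependent ℝ ![v, w]
  · refine ⟨1, one_ne_zero, JoinedIn.ofLine (f := fun s : ℝ => (1 - s) • v + s • w) (by fun_prop)
      (by simp) (by simp) ?_⟩
    rintro _ ⟨s, -, rfl⟩
    refine ⟨fun h => ?_, by simp [QuadraticMap.map_add, QuadraticMap.map_smul, hv.2, hw.2, hvw]⟩
    obtain ⟨h₁, h₂⟩ := LinearIndependent.pair_iff.1 hli _ _ h
    linarith
  · obtain ⟨a, rfl⟩ : ∃ a : ℝ, a • w = v := by
      by_contra! h
      exact hli (LinearIndependent.pair_symm_iff.1 ((LinearIndependent.pair_iff' hw.1).2 h))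
    exact ⟨a, fun ha => hv.1 (by simp [ha]), JoinedIn.refl hv⟩

theorem exists_joinedIn_isotropicCone_of_polar_ne_zero {u v w : V} (hv : v ∈ isotropicCone Q)
    (hw : w ∈ isotropicCone Q) (hvw : QuadraticMap.polar Q v w ≠ 0)
    (hvu : QuadraticMap.polar Q v u = 0) (hwu : QuadraticMap.polar Q w u = 0) (hu : Q u ≠ 0) :
    ∃ c : ℝ, c ≠ 0 ∧ JoinedIn (isotropicCone Q) v (c • w) := by
  -- The span of `v`, `w`, `u` meets the quadric in a nondegenerate conic, and the path is its
  -- rational parametrization.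
  obtain ⟨c, hc, hcQ⟩ : ∃ c ≠ 0, c * QuadraticMap.polar Q v w = -Q u :=
    ⟨-Q u / QuadraticMap.polar Q v w, div_ne_zero (neg_ne_zero.2 hu) hvw, div_mul_cancel₀ _ hvw⟩
  refine ⟨c, hc, JoinedIn.ofLine (f := fun s : ℝ => (1 - s) ^ 2 • v + s ^ 2 • (c • w)
    + (s * (1 - s)) • u) (by fun_prop) (by simp) (by simp) ?_⟩
  rintro _ ⟨s, -, rfl⟩
  refine ⟨fun h => ?_, ?_⟩
  · have hs : s = 0 := by
      simpa [QuadraticMap.polar_self, hv.2, hvu, hvw, hc] using congrArg (Q.polarBilin v) h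
    exact hv.1 (by simpa [hs] using h)
  · rw [QuadraticMap.map_add Q, QuadraticMap.map_add Q]
    simp only [QuadraticMap.map_smul, QuadraticMap.polar_add_left,
      QuadraticMap.polar_smul_left, QuadraticMap.polar_smul_right, smul_eq_mul, hv.2, hw.2, hvu,
      hwu]
    linear_combination (s ^ 2 * (1 - s) ^ 2) * hcQ

theorem exists_joinedIn_isotropicCone (hV : 2 < Module.finrank ℝ V) {v w : V}
    (hv : v ∈ isotropicCone Q) (hw : w ∈ isotropicCone Q) :
    ∃ c : ℝ, c ≠ 0 ∧ JoinedIn (isotropicCone Q) v (c • w) := by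
  have : FiniteDimensional ℝ V := Module.finite_of_finrank_pos (two_pos.trans hV)
  by_cases hvw : QuadraticMap.polar Q v w = 0
  · exact exists_joinedIn_isotropicCone_of_polar_eq_zero hv hw hvw
  obtain ⟨u, hu, hu0⟩ :
      ∃ u ∈ LinearMap.ker ((Q.polarBilin v).prod (Q.polarBilin w)), u ≠ 0 :=
    (Submodule.ne_bot_iff _).1 (LinearMap.ker_ne_bot_of_finrank_lt (by simpa using hV))
  obtain ⟨hvu, hwu⟩ : QuadraticMap.polar Q v u = 0 ∧ QuadraticMap.polar Q w u = 0 := by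
    simpa using hu
  by_cases huu : Q u = 0
  · obtain ⟨c, -, hvcu⟩ := exists_joinedIn_isotropicCone_of_polar_eq_zero hv ⟨hu0, huu⟩ hvu
    obtain ⟨d, hd, hcuw⟩ := exists_joinedIn_isotropicCone_of_polar_eq_zero hvcu.target_mem hw
      (by simp [QuadraticMap.polar_comm Q u w, hwu])
    exact ⟨d, hd, hvcu.trans hcuw⟩
  · exact exists_joinedIn_isotropicCone_of_polar_ne_zero hv hw hvw hvu hwu huu

end Quadric

section Gram

variable {R n : Type*}

theorem pderiv_pderiv_comm [CommRing R] (i j : n) (p : MvPolynomial n R) :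
    MvPolynomial.pderiv i (MvPolynomial.pderiv j p) =
      MvPolynomial.pderiv j (MvPolynomial.pderiv i p) := by
  classical
  have h : (⁅MvPolynomial.pderiv i, MvPolynomial.pderiv j⁆ :
      Derivation R (MvPolynomial n R) (MvPolynomial n R)) = 0 :=
    MvPolynomial.derivation_ext fun k => by
      rw [Derivation.commutator_apply]
      simp [MvPolynomial.pderiv_X, Pi.single_apply, apply_ite]
  rw [← sub_eq_zero, ← Derivation.commutator_apply, h, Derivation.zero_apply]

variable [Field R]

/-- Half the Hessian matrix at the origin; for a quadratic form `Q` this is the symmetric matrix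
`A` with `Q(x) = xᵀ A x`. -/
noncomputable def gramMatrix (Q : MvPolynomial n R) : Matrix n n R :=
  of fun i j => 2⁻¹ * MvPolynomial.constantCoeff (MvPolynomial.pderiv i (MvPolynomial.pderiv j Q))

theorem isSymm_gramMatrix (Q : MvPolynomial n R) : (gramMatrix Q).IsSymm :=
  .ext fun i j => by simp only [gramMatrix, of_apply, pderiv_pderiv_comm]

theorem eval_eq_dotProduct_gramMatrix [Fintype n] [NeZero (2 : R)] {Q : MvPolynomial n R}
    (hQ : Q.IsHomogeneous 2) (x : n → R) :
    MvPolynomial.eval x Q = x ⬝ᵥ gramMatrix Q *ᵥ x := by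
  have hconst : ∀ i j, MvPolynomial.eval x (MvPolynomial.pderiv i (MvPolynomial.pderiv j Q)) =
      2 * gramMatrix Q j i := fun i j => by
    have hdeg : (MvPolynomial.pderiv i (MvPolynomial.pderiv j Q)).totalDegree = 0 :=
      (MvPolynomial.totalDegree_zero_iff_isHomogeneous _).2 (hQ.pderiv (i := j)).pderiv
    rw [← (isSymm_gramMatrix Q).apply, MvPolynomial.totalDegree_eq_zero_iff_eq_C.1 hdeg]
    simp [gramMatrix, two_ne_zero, MvPolynomial.constantCoeff]
  have hgrad : ∀ j, MvPolynomial.eval x (MvPolynomial.pderiv j Q) =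
      2 * (gramMatrix Q *ᵥ x) j := by
    intro j
    have heuler := congrArg (MvPolynomial.eval x) (hQ.pderiv (i := j)).sum_X_mul_pderiv
    calc MvPolynomial.eval x (MvPolynomial.pderiv j Q) = ∑ i, x i * (2 * gramMatrix Q j i) := by
          simpa [hconst] using heuler.symm
      _ = 2 * (gramMatrix Q *ᵥ x) j := by
          simp only [mulVec, dotProduct, Finset.mul_sum]
          exact Finset.sum_congr rfl fun i _ => by ring
  have heuler := congrArg (MvPolynomial.eval x) hQ.sum_X_mul_pderiv
  refine mul_left_cancel₀ (two_ne_zero (α := R)) ?_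
  calc 2 * MvPolynomial.eval x Q = ∑ j, x j * (2 * (gramMatrix Q *ᵥ x) j) := by
        simpa [hgrad] using heuler.symm
    _ = 2 * (x ⬝ᵥ gramMatrix Q *ᵥ x) := by
        simp only [dotProduct, Finset.mul_sum]
        exact Finset.sum_congr rfl fun j _ => by ring

end Gram

section Pencil

/-- The matrix of the quadratic form `t₀² A₁ + 2 t₀ t₁ A₂ + t₁² A₃`. -/
def pencil {R n : Type*} [CommRing R] (A₁ A₂ A₃ : Matrix n n R) (t : Fin 2 → R) : Matrix n n R :=
  t 0 ^ 2 • A₁ + (2 * t 0 * t 1) • A₂ + t 1 ^ 2 • A₃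

variable {R n : Type*} [CommRing R] {A₁ A₂ A₃ : Matrix n n R}

theorem pencil_smul (a : R) (t : Fin 2 → R) :
    pencil A₁ A₂ A₃ (a • t) = a ^ 2 • pencil A₁ A₂ A₃ t := by
  simp only [pencil, Pi.smul_apply, smul_eq_mul]
  module

theorem isSymm_pencil (h₁ : A₁.IsSymm) (h₂ : A₂.IsSymm) (h₃ : A₃.IsSymm) (t : Fin 2 → R) :
    (pencil A₁ A₂ A₃ t).IsSymm :=
  ((h₁.smul _).add (h₂.smul _)).add (h₃.smul _)

theorem continuous_pencil [TopologicalSpace R] [IsTopologicalRing R] :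
    Continuous (pencil A₁ A₂ A₃) := by
  unfold pencil
  fun_prop

end Pencil

section PencilLine

variable {n : Type*} {A₁ A₂ A₃ : Matrix n n ℝ} {t : Fin 2 → ℝ}

theorem posDef_pencil_smul (ht : (pencil A₁ A₂ A₃ t).PosDef) {a : ℝ} (ha : a ≠ 0) :
    (pencil A₁ A₂ A₃ (a • t)).PosDef := by
  rw [pencil_smul]
  exact ht.smul (by positivity)

theorem isOpen_setOf_posDef_pencil [Finite n] (h₁ : A₁.IsSymm) (h₂ : A₂.IsSymm)
    (h₃ : A₃.IsSymm) :
    IsOpen {t | (pencil A₁ A₂ A₃ t).PosDef} :=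
  isOpen_setOf_posDef continuous_pencil fun t =>
    (conjTranspose_eq_transpose_of_trivial _).trans (isSymm_pencil h₁ h₂ h₃ t)

theorem isBounded_setOf_not_posDef_pencil [Finite n] (h₁ : A₁.IsSymm) (h₂ : A₂.IsSymm)
    (h₃ : A₃.IsSymm) (ht : (pencil A₁ A₂ A₃ t).PosDef) (e : Fin 2 → ℝ) :
    Bornology.IsBounded {s : ℝ | ¬ (pencil A₁ A₂ A₃ (s • t + e)).PosDef} := by
  have hlim : Tendsto (fun s : ℝ => t + s⁻¹ • e) (Bornology.cobounded ℝ) (𝓝 t) := by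
    simpa using ((tendsto_inv₀_cobounded (α := ℝ)).smul_const e).const_add t
  have hev : ∀ᶠ s : ℝ in Bornology.cobounded ℝ, (pencil A₁ A₂ A₃ (t + s⁻¹ • e)).PosDef :=
    hlim.eventually ((isOpen_setOf_posDef_pencil h₁ h₂ h₃).mem_nhds ht)
  rw [Bornology.isBounded_def]
  filter_upwards [hev, Bornology.eventually_ne_cobounded 0] with s hs hs0
  have hscale : s • t + e = s • (t + s⁻¹ • e) := by rw [smul_add, smul_inv_smul₀ hs0]
  simpa [hscale] using posDef_pencil_smul hs hs0

theorem card_connectedComponents_not_posDef_pencil_le [Fintype n] (h₁ : A₁.IsSymm)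
    (h₂ : A₂.IsSymm) (h₃ : A₃.IsSymm) (ht : (pencil A₁ A₂ A₃ t).PosDef) (e : Fin 2 → ℝ) :
    ENat.card (ConnectedComponents {s : ℝ | ¬ (pencil A₁ A₂ A₃ (s • t + e)).PosDef}) ≤
      Fintype.card n := by
  let P : Matrix n n ℝ[X] := pencil (A₁.map C) (A₂.map C) (A₃.map C) fun i => C (t i) * X + C (e i)
  have heval : ∀ s, P.map (eval s) = pencil A₁ A₂ A₃ (s • t + e) := by
    intro s
    ext i j
    simp [P, pencil, mul_comm s]
  have hset : {s : ℝ | ¬ (P.map (eval s)).PosDef} =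
      {s | ¬ (pencil A₁ A₂ A₃ (s • t + e)).PosDef} := by
    simp only [heval]
  have hdeg : ∀ i j, (P i j).natDegree ≤ 2 := by
    intro i j
    simp only [P, pencil, Matrix.add_apply, Matrix.smul_apply, map_apply, smul_eq_mul]
    compute_degree
  have hbdd := isBounded_setOf_not_posDef_pencil h₁ h₂ h₃ ht e
  have hcount := card_connectedComponents_not_posDef_le (P := P)
    (isSymm_pencil (h₁.map C) (h₂.map C) (h₃.map C) _) hdeg (hset ▸ hbdd)
  rwa [hset, Nat.mul_div_cancel _ two_pos] at hcount

end PencilLine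

section Fibration

variable {Q₁ Q₂ Q₃ : MvPolynomial (Fin 3) ℝ}

/-- The symmetric matrix `N` for which the fibre of `Y → ℙ¹` over `t` is `xᵀ N x + z² = 0`. -/
noncomputable def fiberMatrix (Q₁ Q₂ Q₃ : MvPolynomial (Fin 3) ℝ) (t : Fin 2 → ℝ) :
    Matrix (Fin 3) (Fin 3) ℝ :=
  pencil (-gramMatrix Q₁) (-gramMatrix Q₂) (-gramMatrix Q₃) t

/-- The quadratic form `xᵀ N x + z²` whose projective quadric is the fibre of `Y → ℙ¹` over `t`. -/
noncomputable def fiberForm (Q₁ Q₂ Q₃ : MvPolynomial (Fin 3) ℝ) (t : Fin 2 → ℝ) :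
    QuadraticForm ℝ ((Fin 3 → ℝ) × ℝ) :=
  (fiberMatrix Q₁ Q₂ Q₃ t).toQuadraticForm'.prod QuadraticMap.sq

/-- The affine cone over the image of `Y(ℝ) → ℙ¹(ℝ)`. -/
def baseLocus (Q₁ Q₂ Q₃ : MvPolynomial (Fin 3) ℝ) : Set (Fin 2 → ℝ) :=
  Prod.fst '' coordinates Q₁ Q₂ Q₃

/-- The connected component of the point of `Y(ℝ)` with given homogeneous coordinates. -/
def component (p : coordinates Q₁ Q₂ Q₃) : ConnectedComponents (RealLocus Q₁ Q₂ Q₃) :=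
  ConnectedComponents.mk (Quotient.mk (scaling Q₁ Q₂ Q₃) p : RealLocus Q₁ Q₂ Q₃)

theorem continuous_component : Continuous (component (Q₁ := Q₁) (Q₂ := Q₂) (Q₃ := Q₃)) :=
  ConnectedComponents.continuous_coe.comp continuous_quot_mk

theorem surjective_component :
    Function.Surjective (component (Q₁ := Q₁) (Q₂ := Q₂) (Q₃ := Q₃)) :=
  ConnectedComponents.surjective_coe.comp Quotient.mk_surjective

theorem component_eq_of_scaling {p q : coordinates Q₁ Q₂ Q₃} {a b : ℝ} (ha : a ≠ 0)
    (hb : b ≠ 0) (h : q.1 = (a • p.1.1, b • p.1.2.1, a * b * p.1.2.2)) :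
    component p = component q :=
  congrArg ConnectedComponents.mk (Quotient.sound ⟨Units.mk0 a ha, Units.mk0 b hb, h⟩)

theorem continuous_fiberMatrix : Continuous (fiberMatrix Q₁ Q₂ Q₃) :=
  continuous_pencil

theorem isHermitian_fiberMatrix (t : Fin 2 → ℝ) : (fiberMatrix Q₁ Q₂ Q₃ t).IsHermitian :=
  (conjTranspose_eq_transpose_of_trivial _).trans <|
    isSymm_pencil (isSymm_gramMatrix Q₁).neg (isSymm_gramMatrix Q₂).neg (isSymm_gramMatrix Q₃).neg t

theorem mem_isotropicCone_fiberForm_iff {t : Fin 2 → ℝ} {v : (Fin 3 → ℝ) × ℝ} :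
    v ∈ isotropicCone (fiberForm Q₁ Q₂ Q₃ t) ↔
      v.1 ≠ 0 ∧ v.2 ^ 2 = -(v.1 ⬝ᵥ fiberMatrix Q₁ Q₂ Q₃ t *ᵥ v.1) := by
  obtain ⟨x, z⟩ := v
  have hform : fiberForm Q₁ Q₂ Q₃ t (x, z) = x ⬝ᵥ fiberMatrix Q₁ Q₂ Q₃ t *ᵥ x + z ^ 2 := by
    simp [fiberForm, toQuadraticForm', toLinearMap₂'_apply', sq]
  have hz : x = 0 → z ^ 2 = -(x ⬝ᵥ fiberMatrix Q₁ Q₂ Q₃ t *ᵥ x) → z = 0 := by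
    rintro rfl
    simp
  simp only [isotropicCone, mem_ofPred_eq, hform, add_eq_zero_iff_neg_eq, Prod.mk_eq_zero, ne_eq]
  grind

section Homogeneous

variable (hQ₁ : Q₁.IsHomogeneous 2) (hQ₂ : Q₂.IsHomogeneous 2) (hQ₃ : Q₃.IsHomogeneous 2)
include hQ₁ hQ₂ hQ₃

theorem mem_coordinates_iff {p : (Fin 2 → ℝ) × (Fin 3 → ℝ) × ℝ} :
    p ∈ coordinates Q₁ Q₂ Q₃ ↔ p.1 ≠ 0 ∧ p.2 ∈ isotropicCone (fiberForm Q₁ Q₂ Q₃ p.1) := by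
  rw [mem_isotropicCone_fiberForm_iff]
  have hfiber : -(p.2.1 ⬝ᵥ fiberMatrix Q₁ Q₂ Q₃ p.1 *ᵥ p.2.1) =
      p.1 0 ^ 2 * MvPolynomial.eval p.2.1 Q₁ + 2 * p.1 0 * p.1 1 * MvPolynomial.eval p.2.1 Q₂ +
        p.1 1 ^ 2 * MvPolynomial.eval p.2.1 Q₃ := by
    simp only [eval_eq_dotProduct_gramMatrix hQ₁, eval_eq_dotProduct_gramMatrix hQ₂,
      eval_eq_dotProduct_gramMatrix hQ₃, fiberMatrix, pencil, add_mulVec, smul_mulVec, neg_mulVec,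
      smul_neg, dotProduct_add, dotProduct_neg, dotProduct_smul, smul_eq_mul]
    ring
  rw [hfiber]
  rfl

theorem component_eq_of_fst_eq {p q : coordinates Q₁ Q₂ Q₃} (hpq : p.1.1 = q.1.1) :
    component p = component q := by
  obtain ⟨⟨t, v⟩, hp⟩ := p
  obtain ⟨⟨t', w⟩, hq⟩ := q
  obtain rfl : t = t' := hpq
  obtain ⟨ht, hv⟩ := (mem_coordinates_iff hQ₁ hQ₂ hQ₃).1 hp
  obtain ⟨c, hc, hvw⟩ := exists_joinedIn_isotropicCone (by simp) hv
    ((mem_coordinates_iff hQ₁ hQ₂ hQ₃).1 hq).2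
  let ι : isotropicCone (fiberForm Q₁ Q₂ Q₃ t) → coordinates Q₁ Q₂ Q₃ := fun u =>
    ⟨(t, u), (mem_coordinates_iff hQ₁ hQ₂ hQ₃).2 ⟨ht, u.2⟩⟩
  have hι : Continuous ι := by fun_prop
  calc component ⟨(t, v), hp⟩ = component (ι ⟨c • w, hvw.target_mem⟩) :=
        eq_of_joined (hvw.joined_subtype.map (continuous_component.comp hι))
    _ = component ⟨(t, w), hq⟩ :=
        (component_eq_of_scaling one_ne_zero hc (by simp [ι, Prod.ext_iff])).symm

theorem component_eq_of_fst_eq_smul {p q : coordinates Q₁ Q₂ Q₃} {a : ℝ} (ha : a ≠ 0)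
    (hpq : q.1.1 = a • p.1.1) : component p = component q := by
  have hmem : (a • p.1.1, p.1.2.1, a * p.1.2.2) ∈ coordinates Q₁ Q₂ Q₃ := by
    obtain ⟨ht, hx, hz⟩ := p.2
    refine ⟨smul_ne_zero ha ht, hx, ?_⟩
    simp only [Pi.smul_apply, smul_eq_mul, mul_pow, hz]
    ring
  calc component p = component ⟨_, hmem⟩ := component_eq_of_scaling ha one_ne_zero (by simp)
    _ = component q := component_eq_of_fst_eq hQ₁ hQ₂ hQ₃ hpq.symm

theorem mem_coordinates_sqrt {t : Fin 2 → ℝ} (ht : t ≠ 0) {x : Fin 3 → ℝ} (hx : x ≠ 0)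
    (h : x ⬝ᵥ fiberMatrix Q₁ Q₂ Q₃ t *ᵥ x ≤ 0) :
    (t, x, √(-(x ⬝ᵥ fiberMatrix Q₁ Q₂ Q₃ t *ᵥ x))) ∈ coordinates Q₁ Q₂ Q₃ :=
  (mem_coordinates_iff hQ₁ hQ₂ hQ₃).2
    ⟨ht, mem_isotropicCone_fiberForm_iff.2 ⟨hx, Real.sq_sqrt (neg_nonneg.2 h)⟩⟩

theorem mem_baseLocus_iff {t : Fin 2 → ℝ} :
    t ∈ baseLocus Q₁ Q₂ Q₃ ↔ t ≠ 0 ∧ ¬ (fiberMatrix Q₁ Q₂ Q₃ t).PosDef := by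
  constructor
  · rintro ⟨p, hp, rfl⟩
    obtain ⟨ht, hv⟩ := (mem_coordinates_iff hQ₁ hQ₂ hQ₃).1 hp
    obtain ⟨hx, hz⟩ := mem_isotropicCone_fiberForm_iff.1 hv
    refine ⟨ht, fun hN => (neg_nonneg.1 (hz ▸ sq_nonneg _)).not_gt ?_⟩
    simpa using hN.re_dotProduct_pos hx
  · rintro ⟨ht, hN⟩
    obtain ⟨x, hx, hle⟩ := (not_posDef_iff_exists_mem_sphere (isHermitian_fiberMatrix t)).1 hN
    exact ⟨_, mem_coordinates_sqrt hQ₁ hQ₂ hQ₃ ht (ne_zero_of_mem_unit_sphere ⟨x, hx⟩)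
      (by simpa using hle), rfl⟩

theorem isQuotientMap_imageFactorization_fst :
    IsQuotientMap (imageFactorization Prod.fst (coordinates Q₁ Q₂ Q₃)) := by
  let form : baseLocus Q₁ Q₂ Q₃ × Metric.sphere (0 : Fin 3 → ℝ) 1 → ℝ := fun y =>
    (y.2 : Fin 3 → ℝ) ⬝ᵥ fiberMatrix Q₁ Q₂ Q₃ y.1 *ᵥ y.2
  have hform : Continuous form := by
    have := continuous_fiberMatrix (Q₁ := Q₁) (Q₂ := Q₂) (Q₃ := Q₃)
    fun_prop
  let K : Set (baseLocus Q₁ Q₂ Q₃ × Metric.sphere (0 : Fin 3 → ℝ) 1) := {y | form y ≤ 0}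
  have hK : IsClosed K := isClosed_le hform continuous_const
  let proj : K → baseLocus Q₁ Q₂ Q₃ := fun y => y.1.1
  have hproj : IsQuotientMap proj := by
    refine IsClosedMap.isQuotientMap ?_ (by fun_prop) ?_
    · exact isClosedMap_fst_of_compactSpace.comp hK.isClosedMap_subtype_val
    · rintro ⟨t, ht⟩
      obtain ⟨x, hx, hle⟩ := (not_posDef_iff_exists_mem_sphere (isHermitian_fiberMatrix t)).1
        ((mem_baseLocus_iff hQ₁ hQ₂ hQ₃).1 ht).2
      exact ⟨⟨(⟨t, ht⟩, ⟨x, hx⟩), by simpa [K, form] using hle⟩, rfl⟩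
  let σ : K → coordinates Q₁ Q₂ Q₃ := fun y =>
    ⟨(y.1.1, y.1.2, √(-form y)), mem_coordinates_sqrt hQ₁ hQ₂ hQ₃
      ((mem_baseLocus_iff hQ₁ hQ₂ hQ₃).1 y.1.1.2).1 (ne_zero_of_mem_unit_sphere _) y.2⟩
  have hσ : Continuous σ := by fun_prop
  have hcomp : imageFactorization Prod.fst (coordinates Q₁ Q₂ Q₃) ∘ σ = proj := rfl
  exact .of_comp hσ (by unfold imageFactorization; fun_prop) (hcomp ▸ hproj)

theorem exists_continuous_baseLocus_component :
    ∃ g : baseLocus Q₁ Q₂ Q₃ → ConnectedComponents (RealLocus Q₁ Q₂ Q₃),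
      Continuous g ∧
        ∀ p : coordinates Q₁ Q₂ Q₃, g ⟨p.1.1, mem_image_of_mem _ p.2⟩ = component p := by
  have hπ := isQuotientMap_imageFactorization_fst hQ₁ hQ₂ hQ₃
  let π : C(coordinates Q₁ Q₂ Q₃, baseLocus Q₁ Q₂ Q₃) := ⟨_, hπ.continuous⟩
  have hfib : Function.FactorsThrough component π := fun p q h =>
    component_eq_of_fst_eq hQ₁ hQ₂ hQ₃ (congrArg Subtype.val h)
  let f : C(coordinates Q₁ Q₂ Q₃, ConnectedComponents (RealLocus Q₁ Q₂ Q₃)) :=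
    ⟨component, continuous_component⟩
  exact ⟨IsQuotientMap.lift (f := π) hπ f hfib, ContinuousMap.continuous _,
    DFunLike.congr_fun (IsQuotientMap.lift_comp (f := π) hπ f hfib)⟩

theorem card_components_le_one (hN : ∀ t, ¬ (fiberMatrix Q₁ Q₂ Q₃ t).PosDef) :
    ENat.card (ConnectedComponents (RealLocus Q₁ Q₂ Q₃)) ≤ 1 := by
  obtain ⟨g, hg, hgp⟩ := exists_continuous_baseLocus_component hQ₁ hQ₂ hQ₃
  have hsurj : Function.Surjective g := surjective_component.forall.2 fun p => ⟨_, hgp p⟩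
  have hbase : baseLocus Q₁ Q₂ Q₃ = {0}ᶜ := by
    ext t
    simp [mem_baseLocus_iff hQ₁ hQ₂ hQ₃, hN]
  have hconn : PreconnectedSpace (baseLocus Q₁ Q₂ Q₃) := by
    rw [hbase]
    exact Subtype.preconnectedSpace
      (isConnected_compl_singleton_of_one_lt_rank (by simp) 0).isPreconnected
  calc ENat.card (ConnectedComponents (RealLocus Q₁ Q₂ Q₃))
      ≤ ENat.card (ConnectedComponents (baseLocus Q₁ Q₂ Q₃)) :=
        card_le_card_connectedComponents hg hsurj
    _ ≤ 1 := (ENat.card_le_one_iff_subsingleton _).2 inferInstance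

theorem exists_smul_mem_of_linearIndependent {t e v : Fin 2 → ℝ}
    (hte : LinearIndependent ℝ ![t, e]) (ht : (fiberMatrix Q₁ Q₂ Q₃ t).PosDef)
    (hv : v ∈ baseLocus Q₁ Q₂ Q₃) :
    ∃ a s : ℝ, a ≠ 0 ∧ v = a • (s • t + e) := by
  obtain ⟨hv0, hvN⟩ := (mem_baseLocus_iff hQ₁ hQ₂ hQ₃).1 hv
  have hspan : v ∈ Submodule.span ℝ {t, e} := by
    have hspan := hte.span_eq_top_of_card_eq_finrank' (by simp)
    rw [range_cons_cons_empty] at hspan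
    exact hspan ▸ Submodule.mem_top
  obtain ⟨b, a, rfl⟩ := Submodule.mem_span_pair.1 hspan
  have ha : a ≠ 0 := by
    rintro rfl
    rw [zero_smul, add_zero] at hv0 hvN
    exact hvN (posDef_pencil_smul ht (left_ne_zero_of_smul hv0))
  exact ⟨a, b / a, ha, by rw [smul_add, smul_smul, mul_div_cancel₀ _ ha]⟩

theorem card_components_le_three_of_posDef {t : Fin 2 → ℝ} (ht : (fiberMatrix Q₁ Q₂ Q₃ t).PosDef) :
    ENat.card (ConnectedComponents (RealLocus Q₁ Q₂ Q₃)) ≤ 3 := by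
  have ht0 : t ≠ 0 := by
    rintro rfl
    simpa [fiberMatrix, pencil] using ht.diag_pos (i := 0)
  obtain ⟨e, hte⟩ := exists_linearIndependent_pair_of_one_lt_finrank (R := ℝ) (by simp) ht0
  let S : Set ℝ := {s | ¬ (fiberMatrix Q₁ Q₂ Q₃ (s • t + e)).PosDef}
  have hS : ∀ s : S, (s : ℝ) • t + e ∈ baseLocus Q₁ Q₂ Q₃ := fun s => by
    refine (mem_baseLocus_iff hQ₁ hQ₂ hQ₃).2 ⟨fun h => ?_, s.2⟩
    simpa using LinearIndependent.pair_iff.1 hte s 1 (by simpa using h)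
  obtain ⟨g, hg, hgp⟩ := exists_continuous_baseLocus_component hQ₁ hQ₂ hQ₃
  have hsurj : Function.Surjective fun s : S => g ⟨(s : ℝ) • t + e, hS s⟩ := by
    refine surjective_component.forall.2 fun p => ?_
    obtain ⟨a, s, ha, hp⟩ := exists_smul_mem_of_linearIndependent hQ₁ hQ₂ hQ₃ hte ht
      (mem_image_of_mem _ p.2)
    have hs : s ∈ S := fun h =>
      ((mem_baseLocus_iff hQ₁ hQ₂ hQ₃).1 (mem_image_of_mem _ p.2)).2 (hp ▸ posDef_pencil_smul h ha)
    obtain ⟨q, hq, hqs⟩ := hS ⟨s, hs⟩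
    refine ⟨⟨s, hs⟩, ?_⟩
    calc g ⟨s • t + e, hS ⟨s, hs⟩⟩ = g ⟨q.1, mem_image_of_mem _ hq⟩ :=
          congrArg g (Subtype.ext hqs.symm)
      _ = component ⟨q, hq⟩ := hgp ⟨q, hq⟩
      _ = component p :=
          component_eq_of_fst_eq_smul hQ₁ hQ₂ hQ₃ ha (hp.trans (congrArg (a • ·) hqs.symm))
  calc ENat.card (ConnectedComponents (RealLocus Q₁ Q₂ Q₃)) ≤ ENat.card (ConnectedComponents S) :=
        card_le_card_connectedComponents (by fun_prop) hsurj
    _ ≤ 3 := by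
        exact card_connectedComponents_not_posDef_pencil_le (isSymm_gramMatrix Q₁).neg
          (isSymm_gramMatrix Q₂).neg (isSymm_gramMatrix Q₃).neg ht e

end Homogeneous

end Fibration

end DoubleCover

theorem lemma2p6_general (Q₁ Q₂ Q₃ : MvPolynomial (Fin 3) ℝ)
    (hQ₁ : Q₁.IsHomogeneous 2) (hQ₂ : Q₂.IsHomogeneous 2) (hQ₃ : Q₃.IsHomogeneous 2) :
    ENat.card (ConnectedComponents (DoubleCover.RealLocus Q₁ Q₂ Q₃)) ≤ 3 := by
  by_cases hN : ∃ t, (DoubleCover.fiberMatrix Q₁ Q₂ Q₃ t).PosDef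
  · obtain ⟨t, ht⟩ := hN
    exact DoubleCover.card_components_le_three_of_posDef hQ₁ hQ₂ hQ₃ ht
  · push Not at hN
    exact (DoubleCover.card_components_le_one hQ₁ hQ₂ hQ₃ hN).trans (by norm_num)

theorem lemma2p6 (Q₁ Q₂ Q₃ : MvPolynomial (Fin 3) ℝ)
    (hQ₁ : Q₁.IsHomogeneous 2) (hQ₂ : Q₂.IsHomogeneous 2) (hQ₃ : Q₃.IsHomogeneous 2)
    (hΔ : DoubleCover.IsSmoothPlaneCurve (Q₁ * Q₃ - Q₂ ^ 2)) :
    ENat.card (ConnectedComponents (DoubleCover.RealLocus Q₁ Q₂ Q₃)) ≤ 3 :=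
  lemma2p6_general Q₁ Q₂ Q₃ hQ₁ hQ₂ hQ₃
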